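/- Let $n\ge 1$ be an integer, let $k$ be a field and let $S=k[x_1,\dots,x_n]$. Let $P_n^2$ be the square of the path graph, that is, the graph on the vertices $x_1,\dots,x_n$ in which $x_i$ and $x_j$ are adjacent if and only if $1\le |i-j|\le 2$. Let $$NI(P_n^2)=\Bigl(\prod_{x_j\in N[x_i]}x_j \;:\; 1\le i\le n\Bigr)\subset S$$ be its closed neighborhood ideal, where $N[x_i]$ consists of $x_i$ and all vertices adjacent to $x_i$. Then $NI(P_n^2)$ is Cohen–Macaulay, i.e. $\operatorname{depth} S/NI(P_n^2)=\dim S/NI(P_n^2)$ (the depth of the graded module $S/NI(P_n^2)$ being the maximal length of a regular sequence on it contained in $(x_1,\dots,x_n)$), if and only if $n\in\{1,2,3,6\}$. -/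

import Mathlib

/-- The square `P_n^2` of the path graph on `n` vertices: besides the edges `{i, i+1}` of the
path it has the edges `{i, i+2}`. -/
def pathSquare (n : ℕ) : SimpleGraph (Fin n) :=
  SimpleGraph.pathGraph n ⊔ SimpleGraph.fromRel fun i j : Fin n => (i : ℕ) + 2 = (j : ℕ)

open Classical in
/-- The closed neighborhood `N[v] = N(v) ∪ {v}` of a vertex of a finite graph. -/
noncomputable def closedNeighborhood {V : Type*} [Fintype V] (G : SimpleGraph V) (v : V) :
    Finset V :=
  Finset.univ.filter fun w => w = v ∨ G.Adj v w

/-- The closed neighborhood ideal `NI(G)` in the polynomial ring over `k` with one variable for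
each vertex: it is generated by the squarefree monomials `∏_{w ∈ N[v]} x_w`. -/
noncomputable def closedNeighborhoodIdeal (k : Type*) [Field k] {V : Type*} [Fintype V]
    (G : SimpleGraph V) : Ideal (MvPolynomial V k) :=
  Ideal.span (Set.range fun v : V => ∏ w ∈ closedNeighborhood G v, MvPolynomial.X w)

/-- The depth of a module `M` with respect to an ideal `J`: the supremum of the lengths of the
`M`-regular sequences with all their elements in `J`. -/
noncomputable def depthAlong {R : Type*} [CommRing R] (J : Ideal R) (M : Type*) [AddCommGroup M]
    [Module R M] : ℕ∞ :=
  ⨆ rs : {l : List R // RingTheory.Sequence.IsRegular M l ∧ ∀ r ∈ l, r ∈ J},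
    ((rs : List R).length : ℕ∞)

/-- A proper homogeneous ideal `I` of a polynomial ring `S` in finitely many variables over a
field is Cohen--Macaulay if `depth (S ⧸ I) = dim (S ⧸ I)`, where the depth of a graded module
is taken with respect to the graded maximal ideal of `S`, which the variables generate. -/
def IsCohenMacaulayIdeal {k : Type*} [Field k] {V : Type*} [Fintype V]
    (I : Ideal (MvPolynomial V k)) : Prop :=
  (depthAlong (Ideal.span (Set.range (MvPolynomial.X : V → MvPolynomial V k)))
      (MvPolynomial V k ⧸ I) : WithBot ℕ∞)
    = ringKrullDim (MvPolynomial V k ⧸ I)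

/-! Depth is at most `dim S/p` for every associated prime `p`, and dimension is at least `dim S/p`
for every prime `p ⊇ NI`. The variables of a dominating set `D` generate a prime containing `NI`, of
dimension `n - |D|`; it is associated when `D` is minimal. The vertices at multiples of three give
depth `≤ n - ⌈n/3⌉`, while centres of blocks of five give dimension `≥ n - ⌈n/5⌉`.
Cohen–Macaulayness thus forces `⌈n/3⌉ ≤ ⌈n/5⌉`, so `n ∈ {1, 2, 3, 6}`.

Conversely, `NI` is principal for `n ≤ 3` and generated by two coprime monomials for `n = 6`, which
bounds the dimension above. A regular sequence of that length consists of differences of variables: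
identifying variables within one monomial is transversal to `NI` (`Tor₁` vanishes, in the form `I ∩
K ⊆ I * K`). -/

/-! ### Depth and associated primes -/

/-- If `r` is regular on `M` and `p ⊆ m` are primes with `p` associated to `M` and `r ∈ m`, then
`M ⧸ rM` has an associated prime between `p + (r)` and `m`. -/
theorem exists_associatedPrime_quotSMulTop {R M : Type*} [CommRing R] [IsNoetherianRing R]
    [AddCommGroup M] [Module R M] [Module.Finite R M] {p m : Ideal R} [m.IsPrime]
    (hp : p ∈ associatedPrimes R M) (hpm : p ≤ m) {r : R} (hr : IsSMulRegular M r)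
    (hrm : r ∈ m) :
    ∃ q ∈ associatedPrimes R (QuotSMulTop r M), p ≤ q ∧ r ∈ q ∧ q ≤ m := by
  obtain ⟨hprime, x, hx⟩ := isAssociatedPrime_iff.mp hp
  have hxp : ∀ a, a ∈ p ↔ a • x = 0 := fun a => by
    rw [hx, Submodule.mem_colon_singleton, Submodule.mem_bot]
  let N : Submodule R M := Submodule.torsionBySet R M p
  have hN : ∀ y, y ∈ N ↔ ∀ a ∈ p, a • y = 0 := fun y => by
    simp [N, Submodule.mem_torsionBySet_iff]
  let π : M →ₗ[R] QuotSMulTop r M := Submodule.mkQ _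
  have hπ : ∀ y, π y = 0 ↔ ∃ z, r • z = y := fun y => by
    simp [π, Submodule.mem_smul_pointwise_iff_exists]
  let Q : Submodule R (QuotSMulTop r M) := N.map π
  have hQ : ∀ a, a ∈ Module.annihilator R Q ↔ ∀ y ∈ N, π (a • y) = 0 := fun a => by
    rw [Submodule.mem_annihilator]
    simp [Q]
  -- If `t` kills `Q`, then `tN ⊆ rM ∩ N = rN` by regularity of `r`. Cayley–Hamilton gives a monic
  -- `f` with lower coefficients in `(r)` and `f(t)N = 0`; evaluating at `x ∈ N` puts `f(t)` in `p ⊆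
  -- m`, hence a power of `t` in `m`.
  have hann : Module.annihilator R Q ≤ m := by
    intro t ht
    rw [hQ] at ht
    obtain ⟨f, hf, -, hcoeff, hfa⟩ :=
      LinearMap.exists_monic_and_natDegree_eq_and_coeff_mem_pow_and_aeval_eq_zero R
        (algebraMap R (Module.End R N) t) (Ideal.span {r}) (by
          rintro _ ⟨y, rfl⟩
          obtain ⟨z, hz⟩ := (hπ _).1 (ht y y.2)
          have hzN : z ∈ N := by
            rw [hN]
            intro a ha
            apply hr
            change r • a • z = r • 0
            rw [smul_comm, hz, smul_comm, (hN _).1 y.2 a ha, smul_zero, smul_zero]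
          rw [Submodule.ideal_span_singleton_smul, Submodule.mem_smul_pointwise_iff_exists]
          exact ⟨⟨z, hzN⟩, trivial, Subtype.ext hz⟩)
    have hxN : x ∈ N := (hN x).2 fun a ha => (hxp a).1 ha
    have he : f.eval t ∈ p := by
      rw [hxp]
      have := congrArg Subtype.val (LinearMap.congr_fun hfa ⟨x, hxN⟩)
      rw [Polynomial.aeval_algebraMap_apply] at this
      simpa using this
    have hpow : t ^ f.natDegree ∈ m := by
      rw [Polynomial.eval_eq_sum_range, Finset.sum_range_succ, hf.coeff_natDegree, one_mul] at he
      refine (Ideal.add_mem_iff_right m (Ideal.sum_mem _ fun i hi => ?_)).1 (hpm he)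
      refine Ideal.mul_mem_right _ _ ?_
      have h1 : f.natDegree - i ≠ 0 := by have := Finset.mem_range.1 hi; omega
      exact (Ideal.span_singleton_le_iff_mem m).2 hrm (Ideal.pow_le_self h1 (hcoeff i))
    exact Ideal.IsPrime.mem_of_pow_mem inferInstance _ hpow
  obtain ⟨q, hq, hqm⟩ := Ideal.exists_minimalPrimes_le hann
  have hass := Module.associatedPrimes.minimalPrimes_annihilator_subset_associatedPrimes R Q hq
  refine ⟨q, associatedPrimes.subset_of_injective (f := Q.subtype) Subtype.val_injective hass,
    fun a ha => hq.1.2 ((hQ a).2 fun y hy => ?_), hq.1.2 ((hQ r).2 fun y _ => ?_), hqm⟩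
  · rw [(hN y).1 hy a ha, map_zero]
  · exact (hπ _).2 ⟨y, rfl⟩

open RingTheory.Sequence in
/-- The length of a weakly regular sequence contained in a prime `m` is at most `dim R ⧸ p` for
every associated prime `p ⊆ m`. -/
theorem length_le_ringKrullDim_quotient_of_mem_associatedPrimes {R : Type*} [CommRing R]
    [IsNoetherianRing R] {m : Ideal R} [m.IsPrime] (rs : List R) (hrs : ∀ r ∈ rs, r ∈ m)
    {M : Type*} [AddCommGroup M] [Module R M] [Module.Finite R M] (h : IsWeaklyRegular M rs)
    {p : Ideal R} (hp : p ∈ associatedPrimes R M) (hpm : p ≤ m) :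
    (rs.length : WithBot ℕ∞) ≤ ringKrullDim (R ⧸ p) := by
  induction rs generalizing M p with
  | nil =>
    have := hp.isPrime
    simpa using ringKrullDim_nonneg_of_nontrivial
  | cons r rs ih =>
    rw [isWeaklyRegular_cons_iff] at h
    have hprime := hp.isPrime
    obtain ⟨q, hq, hpq, hrq, hqm⟩ :=
      exists_associatedPrime_quotSMulTop hp hpm h.1 (hrs r (by simp))
    have h1 := ih (fun s hs => hrs s (by simp [hs])) h.2 hq hqm
    obtain ⟨-, x, hx⟩ := isAssociatedPrime_iff.mp hp
    have hrp : r ∉ p := by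
      intro hrp
      rw [hx, Submodule.mem_colon_singleton, Submodule.mem_bot] at hrp
      have hx0 : x = 0 := h.1 (by simpa using hrp)
      apply hprime.ne_top
      rw [hx, hx0]
      simp
    have h2 := ringKrullDim_succ_le_of_surjective (Ideal.Quotient.factor hpq)
      (Ideal.Quotient.factor_surjective hpq) (r := Ideal.Quotient.mk p r)
      (mem_nonZeroDivisors_of_ne_zero (by rwa [Ne, Ideal.Quotient.eq_zero_iff_mem]))
      (by simpa [Ideal.Quotient.eq_zero_iff_mem] using hrq)
    rw [List.length_cons, Nat.cast_succ]
    refine le_trans ?_ h2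
    gcongr

theorem depthAlong_le_of_mem_associatedPrimes {R : Type*} [CommRing R]
    [IsNoetherianRing R] {m : Ideal R} [m.IsPrime]
    {M : Type*} [AddCommGroup M] [Module R M] [Module.Finite R M]
    {p : Ideal R} (hp : p ∈ associatedPrimes R M) (hpm : p ≤ m) :
    (depthAlong m M : WithBot ℕ∞) ≤ ringKrullDim (R ⧸ p) := by
  have hprime := hp.isPrime
  obtain ⟨d, hd⟩ : ∃ d : ℕ∞, ringKrullDim (R ⧸ p) = d :=
    by
    obtain ⟨d, hd⟩ := WithBot.ne_bot_iff_exists.1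
      (ne_bot_of_le_ne_bot WithBot.zero_ne_bot (ringKrullDim_nonneg_of_nontrivial (R := R ⧸ p)))
    exact ⟨d, hd.symm⟩
  rw [hd, WithBot.coe_le_coe]
  refine iSup_le fun rs => ?_
  rw [← WithBot.coe_le_coe, ← hd]
  exact length_le_ringKrullDim_quotient_of_mem_associatedPrimes _ rs.2.2 rs.2.1.1 hp hpm

/-! ### Primes generated by variables and dominating sets -/

-- Modulo the variables in `D`, a polynomial equals what remains after setting them to zero.
-- Primality and dimension are then read off the polynomial ring on the complement.
open MvPolynomial in
theorem ker_killCompl_eq_span {k V : Type*} [CommRing k] (D : Set V) :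
    RingHom.ker (killCompl (R := k) (Subtype.val_injective (p := fun v => v ∉ D))) =
      Ideal.span (X '' D) := by
  set π := killCompl (R := k) (Subtype.val_injective (p := fun v => v ∉ D)) with hπ
  have hX : ∀ v (h : v ∉ D), π (X v) = X ⟨v, h⟩ := fun v h => by
    have := killCompl_rename_app (R := k) (Subtype.val_injective (p := fun v => v ∉ D)) (X ⟨v, h⟩)
    rwa [rename_X] at this
  have hX0 : ∀ v ∈ D, π (X v) = 0 := fun v h => by
    simp [hπ, killCompl, h]
  apply le_antisymm
  · intro h hh
    have key : ∀ h, h - rename Subtype.val (π h) ∈ Ideal.span (X '' D : Set (MvPolynomial V k)) := by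
      intro h
      rw [← Ideal.Quotient.eq]
      let φ := (Ideal.Quotient.mkₐ k (Ideal.span (X '' D : Set (MvPolynomial V k))))
      have : φ = (φ.comp (rename Subtype.val)).comp π := by
        ext v
        by_cases hv : v ∈ D
        · simp only [AlgHom.comp_apply, hX0 v hv, map_zero]
          exact Ideal.Quotient.eq_zero_iff_mem.2 (Ideal.subset_span ⟨v, hv, rfl⟩)
        · simp [hX v hv]
      exact AlgHom.congr_fun this h
    have h1 := key h
    rwa [RingHom.mem_ker.1 hh, map_zero, sub_zero] at h1
  · rw [Ideal.span_le]
    rintro _ ⟨v, hv, rfl⟩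
    exact hX0 v hv

open MvPolynomial in
theorem isPrime_span_X_image {k V : Type*} [CommRing k] [IsDomain k] (D : Set V) :
    (Ideal.span (X '' D : Set (MvPolynomial V k))).IsPrime := by
  rw [← ker_killCompl_eq_span]
  exact RingHom.ker_isPrime _

open MvPolynomial in
theorem ringKrullDim_quotient_span_X_image {k V : Type*} [Field k] [Fintype V] (D : Finset V) :
    ringKrullDim (MvPolynomial V k ⧸ Ideal.span (X '' (D : Set V) : Set (MvPolynomial V k))) =
      ((Fintype.card V - D.card : ℕ) : WithBot ℕ∞) := by
  classical
  have hs : Function.Surjective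
      (killCompl (R := k) (Subtype.val_injective (p := fun v => v ∉ (D : Set V)))) :=
    fun q => ⟨_, killCompl_rename_app _ q⟩
  rw [← ker_killCompl_eq_span,
    ringKrullDim_eq_of_ringEquiv (Ideal.quotientKerAlgEquivOfSurjective hs).toRingEquiv,
    ringKrullDim_of_isNoetherianRing, ringKrullDim_eq_zero_of_field, zero_add]
  congr 1
  have : Fintype.card V - D.card = Fintype.card {v // v ∉ D} := by
    rw [Fintype.card_subtype_compl, Fintype.card_coe]
  rw [this, ← Nat.card_eq_fintype_card]
  rfl

open MvPolynomial in
theorem X_mem_span_X_image_iff {k V : Type*} [CommRing k] [Nontrivial k] (D : Set V) (v : V) :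
    (X v : MvPolynomial V k) ∈ Ideal.span (X '' D : Set (MvPolynomial V k)) ↔ v ∈ D := by
  rw [mem_ideal_span_X_image]
  classical
  simp [support_X, Finsupp.single_apply]

open MvPolynomial in
theorem closedNeighborhoodIdeal_le_span_X_image (k : Type*) [Field k] {V : Type*} [Fintype V]
    (G : SimpleGraph V) (D : Finset V) (hD : ∀ v, ∃ w ∈ D, w ∈ closedNeighborhood G v) :
    closedNeighborhoodIdeal k G ≤ Ideal.span (X '' (D : Set V)) := by
  rw [closedNeighborhoodIdeal, Ideal.span_le]
  rintro _ ⟨v, rfl⟩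
  obtain ⟨w, hw, hwv⟩ := hD v
  exact Ideal.mem_of_dvd _ (Finset.dvd_prod_of_mem _ hwv) (Ideal.subset_span ⟨w, hw, rfl⟩)

open MvPolynomial in
/-- A dominating set of size `d` bounds the dimension of the closed neighborhood ideal below. -/
theorem le_ringKrullDim_of_dominating (k : Type*) [Field k] {V : Type*} [Fintype V]
    (G : SimpleGraph V) (D : Finset V) (hD : ∀ v, ∃ w ∈ D, w ∈ closedNeighborhood G v) :
    ((Fintype.card V - D.card : ℕ) : WithBot ℕ∞) ≤
      ringKrullDim (MvPolynomial V k ⧸ closedNeighborhoodIdeal k G) := by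
  have hle := closedNeighborhoodIdeal_le_span_X_image k G D hD
  rw [← ringKrullDim_quotient_span_X_image (k := k)]
  exact ringKrullDim_le_of_surjective (Ideal.Quotient.factor hle)
    (Ideal.Quotient.factor_surjective hle)

open MvPolynomial in
/-- The prime of a minimal dominating set is associated to the closed neighborhood ideal. -/
theorem span_X_image_mem_associatedPrimes (k : Type*) [Field k] {V : Type*} [Fintype V]
    (G : SimpleGraph V) (D : Finset V) (hD : ∀ v, ∃ w ∈ D, w ∈ closedNeighborhood G v)
    (hmin : ∀ w ∈ D, ∃ v, w ∈ closedNeighborhood G v ∧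
      ∀ u ∈ D, u ∈ closedNeighborhood G v → u = w) :
    Ideal.span (X '' (D : Set V)) ∈ associatedPrimes (MvPolynomial V k)
      (MvPolynomial V k ⧸ closedNeighborhoodIdeal k G) := by
  classical
  have hprime := isPrime_span_X_image (k := k) (D : Set V)
  -- The class of the product of the variables outside `D` has annihilator `(X_w : w ∈ D)`:
  -- multiplied by `X_w`, it is divisible by the generator of a `v` whose closed neighborhood meets
  -- `D` only in `w`, and the product itself avoids the prime.
  refine isAssociatedPrime_iff.2 ⟨hprime,
    Ideal.Quotient.mk _ (∏ u ∈ Finset.univ \ D, X u), ?_⟩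
  ext h
  rw [Submodule.mem_colon_singleton, Submodule.mem_bot, ← Ideal.Quotient.mk_eq_mk,
    ← Submodule.Quotient.mk_smul, Ideal.Quotient.mk_eq_mk, Ideal.Quotient.eq_zero_iff_mem,
    smul_eq_mul]
  constructor
  · intro hh
    rw [mul_comm]
    suffices Ideal.span (X '' (D : Set V)) ≤ (closedNeighborhoodIdeal k G).colon
        {∏ u ∈ Finset.univ \ D, X u} by
      have h1 := this hh
      rw [Submodule.mem_colon_singleton] at h1
      rwa [mul_comm, ← smul_eq_mul]
    rw [Ideal.span_le]
    rintro _ ⟨w, hw, rfl⟩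
    obtain ⟨v, hwv, huniq⟩ := hmin w hw
    rw [SetLike.mem_coe, Submodule.mem_colon_singleton, smul_eq_mul,
      ← Finset.prod_insert (by simpa using hw)]
    refine Ideal.mem_of_dvd _ (Finset.prod_dvd_prod_of_subset _ _ _ ?_)
      (Ideal.subset_span ⟨v, rfl⟩)
    intro u hu
    by_cases huD : u ∈ D
    · simp [huniq u huD hu]
    · simp [huD]
  · intro hh
    refine (hprime.mem_or_mem
      (closedNeighborhoodIdeal_le_span_X_image k G D hD hh)).resolve_right fun h1 => ?_
    obtain ⟨u, hu, hu'⟩ := (Ideal.IsPrime.prod_mem_iff).1 h1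
    rw [X_mem_span_X_image_iff] at hu'
    simp at hu hu'
    exact hu hu'

/-! ### Dominating sets of the square of a path -/

theorem mem_closedNeighborhood_pathSquare {n : ℕ} (i j : Fin n) :
    j ∈ closedNeighborhood (pathSquare n) i ↔ (i : ℕ) ≤ j + 2 ∧ (j : ℕ) ≤ i + 2 := by
  simp only [closedNeighborhood, pathSquare, Finset.mem_filter, Finset.mem_univ, true_and,
    SimpleGraph.sup_adj, SimpleGraph.pathGraph_adj, SimpleGraph.fromRel_adj, Fin.ext_iff, ne_eq]
  omega

theorem exists_dominating_pathSquare {n : ℕ} :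
    ∃ D : Finset (Fin n), D.card ≤ (n + 4) / 5 ∧
      ∀ v, ∃ w ∈ D, w ∈ closedNeighborhood (pathSquare n) v := by
  classical
  rcases Nat.eq_zero_or_pos n with rfl | hn
  · exact ⟨∅, by simp, fun v => v.elim0⟩
  -- Centres of consecutive blocks of five; `min` keeps the centre of an incomplete last block in
  -- range.
  refine ⟨(Finset.range ((n + 4) / 5)).image fun t => ⟨min (5 * t + 2) (n - 1), by omega⟩,
    Finset.card_image_le.trans (by simp), fun v => ⟨_, Finset.mem_image_of_mem _
      (Finset.mem_range.2 (?_ : (v : ℕ) / 5 < _)), ?_⟩⟩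
  · have := v.2
    omega
  · have := v.2
    rw [mem_closedNeighborhood_pathSquare]
    dsimp only
    omega

/-- The multiples of three are a minimal dominating set of the square of a path. -/
theorem exists_minimal_dominating_pathSquare (n : ℕ) :
    ∃ D : Finset (Fin n), D.card = (n + 2) / 3 ∧
      (∀ v, ∃ w ∈ D, w ∈ closedNeighborhood (pathSquare n) v) ∧
      ∀ w ∈ D, ∃ v, w ∈ closedNeighborhood (pathSquare n) v ∧
        ∀ u ∈ D, u ∈ closedNeighborhood (pathSquare n) v → u = w := by
  classical
  let f : Fin ((n + 2) / 3) → Fin n := fun t => ⟨3 * t, by have := t.2; omega⟩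
  have hf : Function.Injective f := fun a b h => by
    simp only [f, Fin.mk.injEq] at h
    omega
  refine ⟨Finset.univ.image f, by simp [Finset.card_image_of_injective _ hf], fun v => ?_, ?_⟩
  · have := v.2
    refine ⟨f ⟨v / 3, by omega⟩, Finset.mem_image_of_mem _ (Finset.mem_univ _), ?_⟩
    rw [mem_closedNeighborhood_pathSquare]
    dsimp only [f]
    omega
  · intro w hw
    -- Distinct multiples of three are never adjacent, so `w` is its own private neighbor.
    refine ⟨w, (mem_closedNeighborhood_pathSquare w w).2 (by omega), fun u hu huw => ?_⟩
    obtain ⟨a, -, rfl⟩ := Finset.mem_image.1 hu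
    obtain ⟨b, -, rfl⟩ := Finset.mem_image.1 hw
    rw [mem_closedNeighborhood_pathSquare] at huw
    dsimp only [f] at huw
    congr 1
    omega

/-! ### Regular sequences of differences of variables -/

/-- Write `a * y = i + c`. The hypothesis puts `i` in `aI + IK`, so `a * (y - j) ∈ K` for some `j ∈
I`, and `a` cancels modulo the prime `K`. -/
theorem mem_sup_of_mul_mem_sup {R : Type*} [CommRing R] {I K : Ideal R} [K.IsPrime] {a : R}
    (ha : a ∉ K) (h : I ⊓ (Ideal.span {a} ⊔ K) ≤ I * (Ideal.span {a} ⊔ K)) {y : R}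
    (hy : a * y ∈ I ⊔ K) : y ∈ I ⊔ K := by
  obtain ⟨i, hi, c, hc, hic⟩ := Submodule.mem_sup.1 hy
  have h1 : i ∈ I * (Ideal.span {a} ⊔ K) := by
    refine h ⟨hi, ?_⟩
    rw [eq_sub_of_add_eq hic]
    exact sub_mem (Ideal.mul_mem_right _ _
      (Ideal.mem_sup_left (Ideal.mem_span_singleton_self a))) (Ideal.mem_sup_right hc)
  rw [Ideal.mul_sup, mul_comm I] at h1
  obtain ⟨u, hu, d, hd, hud⟩ := Submodule.mem_sup.1 h1
  obtain ⟨j, hj, rfl⟩ := Ideal.mem_span_singleton_mul.1 hu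
  have h2 : a * (y - j) ∈ K := by
    have : a * (y - j) = d + c := by linear_combination -hic - hud
    rw [this]
    exact add_mem (Ideal.mul_le_right (I := I) (J := K) hd) hc
  have h3 := (Ideal.IsPrime.mem_or_mem inferInstance h2).resolve_left ha
  rw [← sub_add_cancel y j, add_comm]
  exact add_mem (Ideal.mem_sup_left hj) (Ideal.mem_sup_right h3)

open RingTheory.Sequence in
theorem isRegular_quotient_of_forall_take {R : Type*} [CommRing R] {I : Ideal R} {rs : List R}
    (hprime : ∀ i, (Ideal.ofList (rs.take i)).IsPrime)
    (hmem : ∀ i (h : i < rs.length), rs[i] ∉ Ideal.ofList (rs.take i))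
    (hI : ∀ i, I ⊓ Ideal.ofList (rs.take i) ≤ I * Ideal.ofList (rs.take i))
    (htop : I ⊔ Ideal.ofList rs ≠ ⊤) : IsRegular (R ⧸ I) rs := by
  have hsmul : ∀ (K : Ideal R) (y : R),
      (Submodule.mkQ I y ∈ (K • ⊤ : Submodule R (R ⧸ I))) ↔ y ∈ I ⊔ K := by
    intro K y
    have : (K • ⊤ : Submodule R (R ⧸ I)) = Submodule.map (Submodule.mkQ I) K := by
      rw [← Submodule.range_mkQ I, LinearMap.range_eq_map, ← Submodule.map_smul'']
      simp
    rw [this, ← Submodule.mem_comap, Submodule.comap_map_mkQ]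
  refine ⟨⟨fun i hi => ?_⟩, fun h => htop ?_⟩
  · rw [isSMulRegular_iff_right_eq_zero_of_smul]
    intro m hm
    obtain ⟨m, rfl⟩ := Submodule.mkQ_surjective _ m
    obtain ⟨y, rfl⟩ := Submodule.mkQ_surjective _ m
    rw [← map_smul, ← map_smul, ← LinearMap.mem_ker, Submodule.ker_mkQ, hsmul, smul_eq_mul] at hm
    rw [← LinearMap.mem_ker, Submodule.ker_mkQ, hsmul]
    have := hprime i
    refine mem_sup_of_mul_mem_sup (hmem i hi) ?_ hm
    -- Regularity of the `i`-th element uses transversality for the prefix that includes it.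
    have h2 := hI (i + 1)
    rwa [List.take_add_one, List.getElem?_eq_getElem hi, Option.toList_some, Ideal.ofList_append,
      Ideal.ofList_singleton, sup_comm] at h2
  · rw [Ideal.eq_top_iff_one, ← hsmul, ← h]
    trivial

open Classical in
/-- The map `s` on the indices in `l` and the identity elsewhere. -/
noncomputable def mapOn {V : Type*} (s : V → V) (l : List V) (v : V) : V := if v ∈ l then s v else v

open MvPolynomial in
theorem ofList_X_sub_X_eq_ker {k V : Type*} [CommRing k] (s : V → V) (l : List V)
    (hs : ∀ v ∈ l, s v ∉ l) :
    Ideal.ofList (l.map fun v => (X v - X (s v) : MvPolynomial V k)) =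
      RingHom.ker (rename (R := k) (mapOn s l)) := by
  apply le_antisymm
  · refine Ideal.span_le.2 fun r hr => ?_
    obtain ⟨v, hv, rfl⟩ := List.mem_map.1 hr
    simp [RingHom.mem_ker, mapOn, hv, hs v hv]
  · intro h hh
    set J := Ideal.ofList (l.map fun v => (X v - X (s v) : MvPolynomial V k)) with hJ
    have : Ideal.Quotient.mkₐ k J = (Ideal.Quotient.mkₐ k J).comp (rename (mapOn s l)) := by
      ext v
      by_cases hv : v ∈ l
      · simp only [AlgHom.comp_apply, rename_X, mapOn, hv, if_true]
        exact Ideal.Quotient.eq.2 (Ideal.subset_span (List.mem_map.2 ⟨v, hv, rfl⟩))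
      · simp [mapOn, hv]
    rw [← Ideal.Quotient.eq_zero_iff_mem]
    have h1 := AlgHom.congr_fun this h
    rw [AlgHom.comp_apply, RingHom.mem_ker.1 hh, map_zero] at h1
    exact h1

theorem mapOn_mapOn {V : Type*} (s : V → V) (l : List V) (hs : ∀ v ∈ l, s v ∉ l) (v : V) :
    mapOn s l (mapOn s l v) = mapOn s l v := by
  by_cases hv : v ∈ l <;> simp [mapOn, hv, hs]

-- Each prefix of the sequence `X v - X (s v)` generates the kernel of a substitution into a domain,
-- hence a prime; only transversality to `I` remains to be supplied.
open MvPolynomial in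
theorem le_depthAlong_quotient {k V : Type*} [Field k] [Fintype V]
    {I : Ideal (MvPolynomial V k)} (hIm : I ≤ Ideal.span (Set.range X))
    (s : V → V) (l : List V) (hl : l.Nodup) (hs : ∀ v ∈ l, s v ∉ l)
    (hI : ∀ i, I ⊓ RingHom.ker (rename (R := k) (mapOn s (l.take i))) ≤
      I * RingHom.ker (rename (R := k) (mapOn s (l.take i)))) :
    (l.length : ℕ∞) ≤ depthAlong (Ideal.span (Set.range (X : V → MvPolynomial V k)))
      (MvPolynomial V k ⧸ I) := by
  have hs' : ∀ i, ∀ v ∈ l.take i, s v ∉ l.take i := fun i v hv h =>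
    hs v (List.mem_of_mem_take hv) (List.mem_of_mem_take h)
  have hker : ∀ i, Ideal.ofList ((l.map fun v => (X v - X (s v) : MvPolynomial V k)).take i) =
      RingHom.ker (rename (R := k) (mapOn s (l.take i))) := fun i => by
    rw [← List.map_take, ofList_X_sub_X_eq_ker s _ (hs' i)]
  have hmem : ∀ r ∈ l.map (fun v => (X v - X (s v) : MvPolynomial V k)),
      r ∈ Ideal.span (Set.range (X : V → MvPolynomial V k)) := by
    intro r hr
    obtain ⟨v, -, rfl⟩ := List.mem_map.1 hr
    exact sub_mem (Ideal.subset_span ⟨v, rfl⟩) (Ideal.subset_span ⟨_, rfl⟩)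
  refine le_trans (by simp) (le_iSup _ ⟨l.map fun v => (X v - X (s v) : MvPolynomial V k),
    isRegular_quotient_of_forall_take (fun i => ?_) (fun i hi => ?_) (fun i => ?_) ?_, hmem⟩)
  · rw [hker]
    exact RingHom.ker_isPrime _
  · have hi' : i < l.length := by simpa using hi
    have h1 : l[i] ∉ l.take i := by
      intro h
      obtain ⟨j, hj, hj'⟩ := List.mem_take_iff_getElem.1 h
      have := (hl.getElem_inj_iff).1 hj'
      omega
    have h2 : s l[i] ∉ l.take i := fun h => hs _ (List.getElem_mem hi') (List.mem_of_mem_take h)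
    rw [hker, RingHom.mem_ker, List.getElem_map, map_sub, rename_X, rename_X, sub_eq_zero,
      (X_injective (σ := V) (R := k)).eq_iff]
    simp only [mapOn, h1, h2, if_false]
    intro h
    exact hs _ (List.getElem_mem hi') (h ▸ List.getElem_mem hi')
  · rw [hker]
    exact hI i
  · have hprime := isPrime_span_X_image (k := k) (Set.univ : Set V)
    rw [Set.image_univ] at hprime
    exact ne_top_of_le_ne_top hprime.ne_top (sup_le hIm (Ideal.span_le.2 hmem))

theorem span_singleton_inf_le_mul {R : Type*} [CommRing R] {K : Ideal R} [K.IsPrime] {f : R}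
    (hf : f ∉ K) : Ideal.span {f} ⊓ K ≤ Ideal.span {f} * K := by
  rintro _ ⟨h1, h2⟩
  obtain ⟨p, rfl⟩ := Ideal.mem_span_singleton'.1 h1
  rw [mul_comm p]
  exact Ideal.mul_mem_mul (Ideal.mem_span_singleton_self f)
    ((Ideal.IsPrime.mem_or_mem inferInstance h2).resolve_right hf)

/-- If the images of `f` and `g` under an idempotent endomorphism `π` are coprime, then
`Tor₁(R ⧸ (f, g), R ⧸ ker π)` vanishes. -/
theorem span_pair_inf_ker_le_mul {R : Type*} [CommRing R] [IsDomain R] [DecompositionMonoid R]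
    (π : R →+* R) (hπ : ∀ x, π (π x) = π x) {f g : R} (hf : π f ≠ 0)
    (hfg : IsRelPrime (π f) (π g)) :
    Ideal.span {f, g} ⊓ RingHom.ker π ≤ Ideal.span {f, g} * RingHom.ker π := by
  rintro _ ⟨h1, h2⟩
  obtain ⟨p, q, rfl⟩ := Ideal.mem_span_pair.1 h1
  have h3 : π p * π f + π q * π g = 0 := by simpa using h2
  -- By coprimality the relation between `π f` and `π g` is a multiple of the Koszul one.
  -- Subtracting its lift from `(p, q)` leaves coefficients in `ker π`.
  obtain ⟨t, ht⟩ : π f ∣ π q := hfg.dvd_of_dvd_mul_right (y := π q)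
    ⟨-π p, by linear_combination h3⟩
  have ht' : π q = π f * π t := by
    have := congrArg π ht
    rwa [hπ, map_mul, hπ] at this
  have hp : π p = -(π g * π t) := by
    apply mul_left_cancel₀ hf
    linear_combination h3 - π g * ht'
  have : p * f + q * g = f * (p + g * t) + g * (q - f * t) := by ring
  rw [this]
  refine add_mem (Ideal.mul_mem_mul (Ideal.subset_span (by simp)) ?_)
    (Ideal.mul_mem_mul (Ideal.subset_span (by simp)) ?_)
  · simp [RingHom.mem_ker, hp]
  · simp [RingHom.mem_ker, ht']

open MvPolynomial in
theorem rename_prod_X_ne_zero {k V W : Type*} [Field k] (s : V → W) (A : Finset V) :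
    rename s (∏ v ∈ A, X v : MvPolynomial V k) ≠ 0 := by
  simp [map_prod, Finset.prod_ne_zero_iff, X_ne_zero]

open MvPolynomial in
theorem isRelPrime_rename_prod_X {k V W : Type*} [Field k] (s : V → W) {A B : Finset V}
    (h : ∀ a ∈ A, ∀ b ∈ B, s a ≠ s b) :
    IsRelPrime (rename s (∏ v ∈ A, X v : MvPolynomial V k)) (rename s (∏ v ∈ B, X v)) := by
  simp only [map_prod, rename_X]
  refine IsRelPrime.prod_left fun a ha => IsRelPrime.prod_right fun b hb => ?_
  refine ((X_prime (i := s a)).irreducible.isRelPrime_iff_not_dvd).2 fun hd => ?_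
  rw [X_dvd_X] at hd
  exact h a ha b hb (by simpa using hd)

/-! ### Dimension bounds and ideals with at most two generators -/

open MvPolynomial in
theorem ringKrullDim_quotient_span_singleton_le {k V : Type*} [Field k] [Fintype V]
    {f : MvPolynomial V k} (hf : f ≠ 0) :
    ringKrullDim (MvPolynomial V k ⧸ Ideal.span {f}) + 1 ≤ (Fintype.card V : WithBot ℕ∞) := by
  refine (ringKrullDim_quotient_succ_le_of_nonZeroDivisor
    (mem_nonZeroDivisors_of_ne_zero hf)).trans ?_
  simp [ringKrullDim_of_isNoetherianRing]

open MvPolynomial in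
theorem ringKrullDim_quotient_span_pair_le {k V : Type*} [Field k] [Fintype V]
    {f g : MvPolynomial V k} (hf : f ≠ 0) (hfg : IsRelPrime f g) :
    ringKrullDim (MvPolynomial V k ⧸ Ideal.span {f, g}) + 1 + 1 ≤
      (Fintype.card V : WithBot ℕ∞) := by
  have hle : Ideal.span {f} ≤ Ideal.span {f, g} := Ideal.span_mono (by simp)
  refine le_trans ?_ (ringKrullDim_quotient_span_singleton_le hf)
  gcongr
  refine ringKrullDim_succ_le_of_surjective (Ideal.Quotient.factor hle)
    (Ideal.Quotient.factor_surjective hle) (r := Ideal.Quotient.mk _ g) ?_ ?_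
  · rw [mem_nonZeroDivisors_iff_right]
    intro x hx
    obtain ⟨x, rfl⟩ := Ideal.Quotient.mk_surjective x
    rw [← map_mul, Ideal.Quotient.eq_zero_iff_mem, Ideal.mem_span_singleton] at hx
    rw [Ideal.Quotient.eq_zero_iff_mem, Ideal.mem_span_singleton]
    exact hfg.dvd_of_dvd_mul_right hx
  · rw [Ideal.Quotient.factor_mk, Ideal.Quotient.eq_zero_iff_mem]
    exact Ideal.subset_span (by simp)

open MvPolynomial in
theorem closedNeighborhoodIdeal_eq_span_pair (k : Type*) [Field k] {V : Type*} [Fintype V]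
    (G : SimpleGraph V) (a b : V)
    (h : ∀ v, closedNeighborhood G a ⊆ closedNeighborhood G v ∨
      closedNeighborhood G b ⊆ closedNeighborhood G v) :
    closedNeighborhoodIdeal k G =
      Ideal.span {∏ v ∈ closedNeighborhood G a, X v, ∏ v ∈ closedNeighborhood G b, X v} := by
  apply le_antisymm
  · refine Ideal.span_le.2 ?_
    rintro _ ⟨v, rfl⟩
    rcases h v with h | h
    · exact Ideal.mem_of_dvd _ (Finset.prod_dvd_prod_of_subset _ _ _ h)
        (Ideal.subset_span (by simp))
    · exact Ideal.mem_of_dvd _ (Finset.prod_dvd_prod_of_subset _ _ _ h)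
        (Ideal.subset_span (by simp))
  · refine Ideal.span_mono ?_
    rintro _ (rfl | rfl)
    · exact ⟨a, rfl⟩
    · exact ⟨b, rfl⟩

open MvPolynomial in
theorem closedNeighborhoodIdeal_le_span_range_X (k : Type*) [Field k] {V : Type*} [Fintype V]
    (G : SimpleGraph V) :
    closedNeighborhoodIdeal k G ≤ Ideal.span (Set.range X) := by
  have := closedNeighborhoodIdeal_le_span_X_image k G Finset.univ
    fun v => ⟨v, Finset.mem_univ v, by simp [closedNeighborhood]⟩
  rwa [Finset.coe_univ, Set.image_univ] at this

open MvPolynomial in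
/-- A minimal dominating set of size `d` bounds the depth of the closed neighborhood ideal
above. -/
theorem depthAlong_le_of_minimal_dominating (k : Type*) [Field k] {V : Type*} [Fintype V]
    (G : SimpleGraph V) (D : Finset V) (hD : ∀ v, ∃ w ∈ D, w ∈ closedNeighborhood G v)
    (hmin : ∀ w ∈ D, ∃ v, w ∈ closedNeighborhood G v ∧
      ∀ u ∈ D, u ∈ closedNeighborhood G v → u = w) :
    depthAlong (Ideal.span (Set.range (X : V → MvPolynomial V k)))
      (MvPolynomial V k ⧸ closedNeighborhoodIdeal k G) ≤ (Fintype.card V - D.card : ℕ) := by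
  have hprime := isPrime_span_X_image (k := k) (Set.univ : Set V)
  rw [Set.image_univ] at hprime
  have h := depthAlong_le_of_mem_associatedPrimes
    (span_X_image_mem_associatedPrimes k G D hD hmin)
    (Ideal.span_mono (Set.image_subset_range X (D : Set V)))
  rw [ringKrullDim_quotient_span_X_image] at h
  exact WithBot.coe_le_coe.1 h

/-! ### Cohen–Macaulayness for the square of a path -/

open MvPolynomial in
theorem depthAlong_pathSquare_le (k : Type*) [Field k] (n : ℕ) :
    depthAlong (Ideal.span (Set.range (X : Fin n → MvPolynomial (Fin n) k)))
      (MvPolynomial (Fin n) k ⧸ closedNeighborhoodIdeal k (pathSquare n)) ≤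
        (n - (n + 2) / 3 : ℕ) := by
  obtain ⟨D, hcard, hD, hmin⟩ := exists_minimal_dominating_pathSquare n
  simpa [hcard] using depthAlong_le_of_minimal_dominating k _ D hD hmin

open MvPolynomial in
theorem le_ringKrullDim_pathSquare (k : Type*) [Field k] (n : ℕ) :
    ((n - (n + 4) / 5 : ℕ) : WithBot ℕ∞) ≤
      ringKrullDim (MvPolynomial (Fin n) k ⧸ closedNeighborhoodIdeal k (pathSquare n)) := by
  obtain ⟨D, hcard, hD⟩ := exists_dominating_pathSquare (n := n)
  refine le_trans ?_ (le_ringKrullDim_of_dominating k _ D hD)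
  rw [Fintype.card_fin]
  exact_mod_cast Nat.sub_le_sub_left hcard n

theorem isCohenMacaulayIdeal_pathSquare_of_le (k : Type*) [Field k] {n d : ℕ}
    (hd : d = n - (n + 4) / 5) (hd' : d = n - (n + 2) / 3)
    (hdepth : (d : ℕ∞) ≤
      depthAlong (Ideal.span (Set.range (MvPolynomial.X : Fin n → MvPolynomial (Fin n) k)))
        (MvPolynomial (Fin n) k ⧸ closedNeighborhoodIdeal k (pathSquare n)))
    (hdim : ringKrullDim (MvPolynomial (Fin n) k ⧸ closedNeighborhoodIdeal k (pathSquare n)) ≤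
      (d : WithBot ℕ∞)) :
    IsCohenMacaulayIdeal (closedNeighborhoodIdeal k (pathSquare n)) := by
  have h1 := le_ringKrullDim_pathSquare k n
  have h2 := depthAlong_pathSquare_le k n
  rw [← hd] at h1
  rw [← hd'] at h2
  rw [IsCohenMacaulayIdeal, le_antisymm hdim h1, le_antisymm h2 hdepth]
  rfl

open MvPolynomial in
theorem isCohenMacaulayIdeal_pathSquare_of_le_three (k : Type*) [Field k] {n : ℕ} (hn : 1 ≤ n)
    (hn' : n ≤ 3) : IsCohenMacaulayIdeal (closedNeighborhoodIdeal k (pathSquare n)) := by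
  have : NeZero n := ⟨by omega⟩
  have hI : closedNeighborhoodIdeal k (pathSquare n) =
      Ideal.span {∏ v ∈ closedNeighborhood (pathSquare n) 0, X v} := by
    rw [closedNeighborhoodIdeal_eq_span_pair k (pathSquare n) 0 0, Set.pair_eq_singleton]
    -- For `n ≤ 3` the graph is complete, so all generators coincide.
    refine fun v => Or.inl fun w _ => ?_
    rw [mem_closedNeighborhood_pathSquare]
    omega
  refine isCohenMacaulayIdeal_pathSquare_of_le k (d := n - 1) (by omega) (by omega) ?_ ?_
  · have hl : ((List.finRange n).filter (· ≠ 0)).length = n - 1 := by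
      interval_cases n <;> rfl
    rw [← hl]
    refine le_depthAlong_quotient (closedNeighborhoodIdeal_le_span_range_X k _) (fun _ => 0) _
      ((List.nodup_finRange n).filter _) (by simp) fun i => ?_
    rw [hI]
    have := RingHom.ker_isPrime (rename (R := k) (mapOn (fun _ => (0 : Fin n))
      (((List.finRange n).filter (· ≠ 0)).take i)))
    exact span_singleton_inf_le_mul (rename_prod_X_ne_zero _ _)
  · have h := ringKrullDim_quotient_span_singleton_le (V := Fin n) (k := k)
      (f := ∏ v ∈ closedNeighborhood (pathSquare n) 0, X v)
      (Finset.prod_ne_zero_iff.2 fun v _ => X_ne_zero v)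
    rw [← hI, Fintype.card_fin] at h
    obtain ⟨m, rfl⟩ : ∃ m, n = m + 1 := ⟨n - 1, by omega⟩
    rw [Nat.cast_succ] at h
    exact ENat.WithBot.add_le_add_one_right_iff.1 h

open MvPolynomial in
theorem isCohenMacaulayIdeal_pathSquare_six (k : Type*) [Field k] :
    IsCohenMacaulayIdeal (closedNeighborhoodIdeal k (pathSquare 6)) := by
  -- The end vertices have closed neighborhoods `{0, 1, 2}` and `{3, 4, 5}`; every other one
  -- contains one of these.
  have hI := closedNeighborhoodIdeal_eq_span_pair k (pathSquare 6) 0 5 fun v => by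
    rcases Nat.lt_or_ge v 3 with h | h
    · refine Or.inl fun w => ?_
      simp only [mem_closedNeighborhood_pathSquare, Fin.val_zero]
      omega
    · refine Or.inr fun w => ?_
      simp only [mem_closedNeighborhood_pathSquare, show ((5 : Fin 6) : ℕ) = 5 from rfl]
      omega
  -- Each triple collapses to its own first vertex, so the two monomials stay coprime at every
  -- stage.
  let s : Fin 6 → Fin 6 := ![0, 0, 0, 3, 3, 3]
  have hs : ∀ (l : List (Fin 6)), ∀ a ∈ closedNeighborhood (pathSquare 6) 0,
      ∀ b ∈ closedNeighborhood (pathSquare 6) 5, mapOn s l a ≠ mapOn s l b := by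
    intro l a ha b hb
    rw [mem_closedNeighborhood_pathSquare] at ha hb
    have ha' : (a : ℕ) ≤ 2 := by simpa using ha.2
    have hb' : 3 ≤ (b : ℕ) := by
      have := hb.1
      simp only [show ((5 : Fin 6) : ℕ) = 5 from rfl] at this
      omega
    have h : ∀ a b : Fin 6, (a : ℕ) ≤ 2 → 3 ≤ (b : ℕ) →
        s a ≠ s b ∧ s a ≠ b ∧ a ≠ s b ∧ a ≠ b := by decide
    obtain ⟨h1, h2, h3, h4⟩ := h a b ha' hb'
    unfold mapOn
    split_ifs <;> assumption
  refine isCohenMacaulayIdeal_pathSquare_of_le k (d := 4) (by norm_num) (by norm_num) ?_ ?_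
  · have hl : ∀ v ∈ ([1, 2, 4, 5] : List (Fin 6)), s v ∉ ([1, 2, 4, 5] : List (Fin 6)) := by
      decide
    refine le_depthAlong_quotient (closedNeighborhoodIdeal_le_span_range_X k _) s
      [1, 2, 4, 5] (by decide) hl fun i => ?_
    rw [hI]
    refine span_pair_inf_ker_le_mul (rename (R := k) (mapOn s _)).toRingHom (fun x => ?_)
      (rename_prod_X_ne_zero _ _) (isRelPrime_rename_prod_X _ (hs _))
    change rename _ (rename _ x) = rename _ x
    rw [rename_rename]
    congr 2
    funext v
    exact mapOn_mapOn s _ (fun v hv h => hl v (List.mem_of_mem_take hv)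
      (List.mem_of_mem_take h)) v
  · have h := ringKrullDim_quotient_span_pair_le (V := Fin 6) (k := k)
      (f := ∏ v ∈ closedNeighborhood (pathSquare 6) 0, X v)
      (g := ∏ v ∈ closedNeighborhood (pathSquare 6) 5, X v)
      (Finset.prod_ne_zero_iff.2 fun v _ => X_ne_zero v) (by
        have := isRelPrime_rename_prod_X (k := k) (id : Fin 6 → Fin 6)
          (A := closedNeighborhood (pathSquare 6) 0) (B := closedNeighborhood (pathSquare 6) 5)
          (by simpa [mapOn] using hs [])
        simpa using this)
    rw [← hI, Fintype.card_fin] at h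
    have h6 : ((6 : ℕ) : WithBot ℕ∞) = ((4 : ℕ) : WithBot ℕ∞) + 1 + 1 := rfl
    rw [h6] at h
    exact ENat.WithBot.add_le_add_one_right_iff.1
      (ENat.WithBot.add_le_add_one_right_iff.1 h)

theorem mainTheorem4 (k : Type*) [Field k] (n : ℕ) (hn : 1 ≤ n) :
    IsCohenMacaulayIdeal (closedNeighborhoodIdeal k (pathSquare n)) ↔
      n ∈ ({1, 2, 3, 6} : Set ℕ) := by
  simp only [Set.mem_insert_iff, Set.mem_singleton_iff]
  constructor
  · intro h
    have h1 := le_ringKrullDim_pathSquare k n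
    have h2 := depthAlong_pathSquare_le k n
    rw [IsCohenMacaulayIdeal] at h
    rw [← h] at h1
    have h3 : ((n - (n + 4) / 5 : ℕ) : ℕ∞) ≤ (n - (n + 2) / 3 : ℕ) :=
      (WithBot.coe_le_coe.1 h1).trans h2
    have h4 := Nat.cast_le.1 h3
    -- The inequality amounts to `⌈n/3⌉ ≤ ⌈n/5⌉`.
    omega
  · intro h
    by_cases h3 : n ≤ 3
    · exact isCohenMacaulayIdeal_pathSquare_of_le_three k hn h3
    · obtain rfl : n = 6 := by omega
      exact isCohenMacaulayIdeal_pathSquare_six k
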